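/- All automata are over a finite input alphabet $\Sigma$. For a finite set $Q$, let $\mathcal H_Q$ be the Hilbert space with orthonormal basis $\{|q\rangle : q\in Q\}$. A projective measurement on $\mathcal H_Q$ with finite outcome set $C$ is a family $\{P_c\}_{c\in C}$ of Hermitian projectors with $\sum_c P_c=I$; a general measurement is a family $\{M^c\}_{c\in C}$ of operators with $\sum_c (M^c)^\dagger M^c=I$. A semi-quantum automaton $\mathcal A$ with $q$ quantum basis states and $k$ classical states is one of the following, accepting $x=x_1\cdots x_n\in\Sigma^*$ with probability $\mathcal P_{\mathcal A}(x)$. - CL-1QFA: a finite set $Q$ with $|Q|=q$, an initial $q_1\in Q$, unitaries $U_\sigma$ ($\sigma\in\Sigma$), a projective measurement $\{P_c\}_{c\in C}$, and a regular control language $\mathcal L\subseteq C^*$ whose minimal DFA has $k$ states; $$\mathcal P_{\mathcal A}(x)=\sum_{y_1\cdots y_n\in\mathcal L}\|P_{y_n}U_{x_n}\cdots P_{y_1}U_{x_1}|q_1\rangle\|^2 .$$ - 1QFAC: finite sets $Q,S$ with $|Q|=q$, $|S|=k$, initial $q_1\in Q$ and $s_1\in S$, unitaries $U_{s,\sigma}$,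 a transition function $\tau:S\times\Sigma\to S$, and for each $s\in S$ a projective measurement $\{P_{s,a},P_{s,r}\}$; $$\mathcal P_{\mathcal A}(x)=\|P_{s_{n+1},a}U_{s_n,x_n}\cdots U_{s_1,x_1}|q_1\rangle\|^2,\qquad s_{i+1}=\tau(s_i,x_i).$$ - 1QCFA: finite sets $Q,S,C$ with $|Q|=q$, $|S|=k$, initial $q_1\in Q$ and $s_1\in S$, for each $(s,\sigma)\in S\times\Sigma$ a general measurement $\{M^c_{s,\sigma}\}_{c\in C}$ on $\mathcal H_Q$, a transition function $\tau:S\times\Sigma\times C\to S$, and a set $S_a\subseteq S$ of accepting states; $$\mathcal P_{\mathcal A}(x)=\sum_{c_1\cdots c_n\in C^n:\ s_{n+1}\in S_a}\|M^{c_n}_{s_n,x_n}\cdots M^{c_1}_{s_1,x_1}|q_1\rangle\|^2,\qquad s_{i+1}=\tau(s_i,x_i,c_i).$$ A language $L\subseteq\Sigma^*$ is recognized by $\mathcal A$ with cut-point isolated by $\delta$, where $\delta\in(0,\tfrac12]$, if for some $\lambda\in(0,1]$ we have $\mathcal P_{\mathcal A}(x)>\lambda$ for all $x\in L$, $\mathcal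 P_{\mathcal A}(x)\le\lambda$ for all $x\in\Sigma^*\setminus L$, and $|\mathcal P_{\mathcal A}(x)-\lambda|\ge\delta$ for all $x\in\Sigma^*$. Theorem. Suppose that a semi-quantum automaton (a CL-1QFA, a 1QFAC or a 1QCFA) with $q$ quantum basis states and $k$ classical states recognizes, with cut-point isolated by $\delta$, a regular language whose minimal (complete) DFA has $d$ states. Then $$qk\ \ge\ \left[\frac{\log d}{2\log\frac{2}{\delta}}\right]^{4/9}.$$ -/

import Mathlib

open scoped Matrix

namespace SemiQuantum

/-- `L` is a regular language whose minimal (complete, deterministic) finite automaton has exactly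
`d` states. -/
def HasMinimalDFASize {α : Type*} (L : Language α) (d : ℕ) : Prop :=
  IsLeast {n : ℕ | ∃ M : DFA α (Fin n), M.accepts = L} d

/-- The basis vector `|q⟩` of the Hilbert space spanned by `Q`. -/
def ket {Q : Type*} [DecidableEq Q] (q : Q) : Q → ℂ := Pi.single q 1

/-- The squared Euclidean norm `‖v‖²` of a vector of the Hilbert space spanned by `Q`. -/
noncomputable def normSq {Q : Type*} [Fintype Q] (v : Q → ℂ) : ℝ :=
  ‖(WithLp.toLp 2 v : EuclideanSpace ℂ Q)‖ ^ 2

/-- A general measurement on the Hilbert space spanned by `Q`, with outcome set `C`. -/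
structure GeneralMeasurement (Q C : Type*) [Fintype Q] [DecidableEq Q] [Fintype C] where
  /-- The measurement operators. -/
  op : C → Matrix Q Q ℂ
  complete : ∑ c, (op c)ᴴ * op c = 1

/-- A projective measurement on the Hilbert space spanned by `Q`, with outcome set `C`: a family of
Hermitian idempotents that sum to the identity (and are therefore mutually orthogonal). -/
structure ProjectiveMeasurement (Q C : Type*) [Fintype Q] [DecidableEq Q] [Fintype C] where
  /-- The projectors. -/
  proj : C → Matrix Q Q ℂ
  isProj : ∀ c, IsStarProjection (proj c)
  complete : ∑ c, proj c = 1

/-- The language `L` is recognized, with cut-point isolated by `δ`, by an automaton that accepts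
each word `x` with probability `P x`. -/
def RecognizesIsolated {α : Type*} (P : List α → ℝ) (L : Language α) (δ : ℝ) : Prop :=
  δ ∈ Set.Ioc (0 : ℝ) (1 / 2) ∧
    ∃ cut ∈ Set.Ioc (0 : ℝ) 1,
      (∀ x ∈ L, cut < P x) ∧ (∀ x ∉ L, P x ≤ cut) ∧ ∀ x, δ ≤ |P x - cut|

/-! ### One-way quantum finite automata with control language (CL-1QFA) -/

/-- A CL-1QFA over the alphabet `α`, with quantum basis states `Q` and measurement outcomes `C`. -/
structure CL1QFA (α Q C : Type*) [Fintype Q] [DecidableEq Q] [Fintype C] where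
  /-- The initial quantum state. -/
  start : Q
  /-- The unitary operators. -/
  U : α → Matrix.unitaryGroup Q ℂ
  /-- The projective measurement. -/
  meas : ProjectiveMeasurement Q C
  /-- The control language. -/
  control : Language C
  control_regular : control.IsRegular

namespace CL1QFA

variable {α Q C : Type*} [Fintype Q] [DecidableEq Q] [Fintype C]

/-- The vector `P_{yₙ} U_{xₙ} ⋯ P_{y₁} U_{x₁} |q₁⟩`, for the list of the pairs `(xᵢ, yᵢ)`. -/
noncomputable def state (A : CL1QFA α Q C) (w : List (α × C)) : Q → ℂ :=
  w.foldl (fun v p => A.meas.proj p.2 *ᵥ ((A.U p.1 : Matrix Q Q ℂ) *ᵥ v)) (ket A.start)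

/-- The probability `p(y | x)` of the outcome sequence `y` on the input `x` (of the same length). -/
noncomputable def outcomeProb (A : CL1QFA α Q C) (x : List α) (y : List C) : ℝ :=
  normSq (A.state (x.zip y))

open Classical in
/-- The probability of accepting `x`. -/
noncomputable def acceptProb (A : CL1QFA α Q C) (x : List α) : ℝ :=
  ∑ y : Fin x.length → C,
    if List.ofFn y ∈ A.control then A.outcomeProb x (List.ofFn y) else 0

end CL1QFA

/-! ### One-way quantum finite automata together with classical states (1QFAC) -/

/-- A 1QFAC over the alphabet `α`, with quantum basis states `Q` and classical states `S`. -/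
structure QFAC (α Q S : Type*) [Fintype Q] [DecidableEq Q] where
  /-- The initial quantum state. -/
  start : Q
  /-- The initial classical state. -/
  cstart : S
  /-- The unitary operators. -/
  U : S → α → Matrix.unitaryGroup Q ℂ
  /-- The classical transition function. -/
  step : S → α → S
  /-- The final projective measurements; the outcome `true` is acceptance, `false` rejection. -/
  meas : S → ProjectiveMeasurement Q Bool

namespace QFAC

variable {α Q S : Type*} [Fintype Q] [DecidableEq Q]

/-- The classical state and the quantum state after reading a word. -/
noncomputable def run (A : QFAC α Q S) (x : List α) : S × (Q → ℂ) :=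
  x.foldl (fun p a => (A.step p.1 a, (A.U p.1 a : Matrix Q Q ℂ) *ᵥ p.2)) (A.cstart, ket A.start)

/-- The probability of accepting `x`. -/
noncomputable def acceptProb (A : QFAC α Q S) (x : List α) : ℝ :=
  normSq ((A.meas (A.run x).1).proj true *ᵥ (A.run x).2)

end QFAC

/-! ### One-way finite automata with quantum and classical states (1QCFA) -/

/-- A 1QCFA over the alphabet `α`, with quantum basis states `Q`, classical states `S` and
measurement outcomes `C`. -/
structure QCFA (α Q S C : Type*) [Fintype Q] [DecidableEq Q] [Fintype C] where
  /-- The initial quantum state. -/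
  start : Q
  /-- The initial classical state. -/
  cstart : S
  /-- The general measurements. -/
  meas : S → α → GeneralMeasurement Q C
  /-- The classical transition function. -/
  step : S → α → C → S
  /-- The accepting classical states. -/
  accept : Set S

namespace QCFA

variable {α Q S C : Type*} [Fintype Q] [DecidableEq Q] [Fintype C]

/-- The classical state and the (unnormalized) quantum state after reading the letters `xᵢ` with
outcomes `cᵢ`, for the list of the pairs `(xᵢ, cᵢ)`. -/
noncomputable def run (A : QCFA α Q S C) (w : List (α × C)) : S × (Q → ℂ) :=
  w.foldl (fun p e => (A.step p.1 e.1 e.2, (A.meas p.1 e.1).op e.2 *ᵥ p.2)) (A.cstart, ket A.start)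

open Classical in
/-- The probability of accepting `x`. -/
noncomputable def acceptProb (A : QCFA α Q S C) (x : List α) : ℝ :=
  ∑ c : Fin x.length → C,
    if (A.run (x.zip (List.ofFn c))).1 ∈ A.accept then
      normSq (A.run (x.zip (List.ofFn c))).2
    else 0

end QCFA

end SemiQuantum

/-! All three models are quantum systems steered by a finite automaton (`ControlledSystem`).
Acceptance is quadratic in the quantum state but linear in its density matrix, so reading a word
acts linearly on the families of density matrices indexed by the classical states, a complex space
of dimension `k * q ^ 2`. Hence the probability of accepting `x ++ w` is a linear functional,
depending on `w`, of a vector depending on `x` (`weight_evolveWord_pure`).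

Take `d` pairwise distinguishable words. A separating suffix makes two acceptance probabilities
differ by at least `2 * δ`, so, measured by these suffixes, the `d` vectors are `2 * δ`-separated in
a unit ball of real dimension at most `2 * k * q ^ 2`. Comparing volumes gives `d ≤ (2 / δ) ^ (2 * k
* q ^ 2)` (`log_le`), and `k * q ^ 2 ≤ (q * k) ^ 2 ≤ (q * k) ^ (9 / 4)`. -/

namespace SemiQuantum

open MeasureTheory Module

/-! ### Packing in normed spaces -/

section Packing

variable {E : Type*} [NormedAddCommGroup E] [NormedSpace ℝ E] [FiniteDimensional ℝ E]

/-- A `2δ`-separated family in the unit ball of an `n`-dimensional real normed space has at most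
`(1 + 1 / δ) ^ n` members. -/
theorem card_le_of_separated_unitBall {ι : Type*} [Fintype ι] {δ : ℝ} (hδ : 0 < δ) (v : ι → E)
    (hv : ∀ i, ‖v i‖ ≤ 1) (hsep : Pairwise fun i j => 2 * δ ≤ ‖v i - v j‖) :
    (Fintype.card ι : ℝ) ≤ (1 + 1 / δ) ^ finrank ℝ E := by
  borelize E
  let μ : Measure E := Measure.addHaar
  have hρ : 0 < 1 + δ := by linarith
  have hdisj : Pairwise (Function.onFun Disjoint fun i => Metric.ball (v i) δ) := by
    intro i j hij
    apply Metric.ball_disjoint_ball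
    rw [dist_eq_norm]
    linarith [hsep hij]
  have hsub : (⋃ i, Metric.ball (v i) δ) ⊆ Metric.ball (0 : E) (1 + δ) := by
    refine Set.iUnion_subset fun i => Metric.ball_subset_ball' ?_
    rw [dist_zero_right]
    linarith [hv i]
  -- Haar measure scales by the `n`-th power of the radius, so the volume of the unit ball cancels.
  have hvol : (Fintype.card ι : ENNReal) * ENNReal.ofReal (δ ^ finrank ℝ E) * μ (Metric.ball 0 1) ≤
      ENNReal.ofReal ((1 + δ) ^ finrank ℝ E) * μ (Metric.ball 0 1) :=
    calc
      _ = μ (⋃ i, Metric.ball (v i) δ) := by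
        rw [measure_iUnion hdisj fun _ => measurableSet_ball, tsum_fintype]
        simp only [μ.addHaar_ball_of_pos _ hδ, Finset.sum_const, nsmul_eq_mul, mul_assoc,
          Finset.card_univ]
      _ ≤ μ (Metric.ball (0 : E) (1 + δ)) := measure_mono hsub
      _ = _ := μ.addHaar_ball_of_pos _ hρ
  have hcancel := (ENNReal.mul_le_mul_iff_left
    (Metric.measure_ball_pos μ (0 : E) zero_lt_one).ne' measure_ball_lt_top.ne).1 hvol
  have hreal := ENNReal.toReal_le_of_le_ofReal (pow_nonneg hρ.le _) hcancel
  rw [ENNReal.toReal_mul, ENNReal.toReal_natCast, ENNReal.toReal_ofReal (by positivity)] at hreal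
  have hquot : 1 + 1 / δ = (1 + δ) / δ := by field_simp; ring
  rw [hquot, div_pow, le_div_iff₀ (by positivity)]
  exact hreal

end Packing

/-! ### Distinguishable words and the dimension bound -/

section MyhillNerode

variable {α : Type*}

/-- A language whose minimal automaton has `d` states has `d` pairwise distinguishable words. -/
theorem HasMinimalDFASize.exists_distinguishable {L : Language α} {d : ℕ}
    (hL : HasMinimalDFASize L d) :
    ∃ x : Fin d → List α, Pairwise fun i j => ∃ w, ¬(x i ++ w ∈ L ↔ x j ++ w ∈ L) := by
  obtain ⟨⟨M, hM⟩, hmin⟩ := hL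
  have hreg : L.IsRegular := ⟨Fin d, inferInstance, M, hM⟩
  have hfin := hreg.finite_range_leftQuotient
  have : Fintype (Set.range L.leftQuotient) := hfin.fintype
  -- The left quotients are the states of an automaton for `L`, so minimality bounds `d` by their
  -- number.
  have hd : d ≤ Fintype.card (Set.range L.leftQuotient) :=
    hmin ⟨DFA.reindex (Fintype.equivFin _) L.toDFA, by
      rw [DFA.accepts_reindex, Language.accepts_toDFA]⟩
  rw [← Fintype.card_fin d] at hd
  obtain ⟨f⟩ := Function.Embedding.nonempty_of_card_le hd
  choose x hx using fun i => (f i).2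
  refine ⟨x, fun i j hij => ?_⟩
  by_contra! hall
  refine hij (f.injective (Subtype.ext ?_))
  rw [← hx i, ← hx j]
  ext w
  exact hall w

theorem HasMinimalDFASize.pos {L : Language α} {d : ℕ} (hL : HasMinimalDFASize L d) : 0 < d := by
  obtain ⟨⟨M, -⟩, -⟩ := hL
  exact M.start.pos

/-- If the word function `P` factors through a complex vector space `V`, then the size of the
minimal automaton of a language recognized by `P` with isolated cut-point is at most exponential in
the dimension of `V`. -/
theorem RecognizesIsolated.log_le {L : Language α} {d : ℕ} (hL : HasMinimalDFASize L d)
    {P : List α → ℝ} {δ : ℝ} (hP : RecognizesIsolated P L δ) (hbound : ∀ x, |P x| ≤ 1)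
    {V : Type*} [AddCommGroup V] [Module ℂ V] [FiniteDimensional ℂ V]
    (ρ : List α → V) (f : List α → V →ₗ[ℂ] ℂ) (hf : ∀ x w, f w (ρ x) = (P (x ++ w) : ℂ)) :
    Real.log d ≤ 2 * finrank ℂ V * Real.log (2 / δ) := by
  obtain ⟨⟨hδ, hδ'⟩, cut, -, hacc, hrej, hiso⟩ := hP
  have hgap : ∀ y z, y ∈ L → z ∉ L → 2 * δ ≤ P y - P z := by
    intro y z hy hz
    have h1 := hiso y
    have h2 := hiso z
    rw [abs_of_pos (sub_pos.2 (hacc y hy))] at h1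
    rw [abs_of_nonpos (sub_nonpos.2 (hrej z hz))] at h2
    linarith
  obtain ⟨x, hx⟩ := hL.exists_distinguishable
  have hw : ∀ i j, ∃ w, i ≠ j → 2 * δ ≤ |P (x i ++ w) - P (x j ++ w)| := by
    intro i j
    by_cases hij : i = j
    · exact ⟨[], fun h => absurd hij h⟩
    obtain ⟨w, hw⟩ := hx hij
    refine ⟨w, fun _ => ?_⟩
    by_cases hi : x i ++ w ∈ L
    · have hj : x j ++ w ∉ L := fun hj => hw (by simp [hi, hj])
      exact (hgap _ _ hi hj).trans (le_abs_self _)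
    · have hj : x j ++ w ∈ L := by
        by_contra hj
        exact hw (by simp [hi, hj])
      rw [abs_sub_comm]
      exact (hgap _ _ hj hi).trans (le_abs_self _)
  choose w hw using hw
  -- The sup over the chosen suffixes is only a seminorm on `V`; on the range of `Φ` it is a norm,
  -- and the dimension does not grow.
  let Φ : V →ₗ[ℂ] (Fin d × Fin d → ℂ) := LinearMap.pi fun p => f (w p.1 p.2)
  have hΦ : ∀ i p, Φ (ρ (x i)) p = (P (x i ++ w p.1 p.2) : ℂ) := fun i p => hf _ _
  let v : Fin d → LinearMap.range Φ := fun i => ⟨Φ (ρ (x i)), LinearMap.mem_range_self _ _⟩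
  have hv : ∀ i, ‖v i‖ ≤ 1 := by
    intro i
    change ‖Φ (ρ (x i))‖ ≤ 1
    refine (pi_norm_le_iff_of_nonneg zero_le_one).2 fun p => ?_
    rw [hΦ, Complex.norm_real]
    exact hbound _
  have hsep : Pairwise fun i j => 2 * δ ≤ ‖v i - v j‖ := by
    intro i j hij
    change 2 * δ ≤ ‖Φ (ρ (x i)) - Φ (ρ (x j))‖
    refine le_trans ?_ (norm_le_pi_norm (Φ (ρ (x i)) - Φ (ρ (x j))) (i, j))
    rw [Pi.sub_apply, hΦ, hΦ, ← Complex.ofReal_sub, Complex.norm_real]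
    exact hw i j hij
  -- Volumes need a real space, whence the factor 2 in the exponent.
  have : FiniteDimensional ℝ (LinearMap.range Φ) := FiniteDimensional.complexToReal _
  have hcard := card_le_of_separated_unitBall hδ v hv hsep
  rw [Fintype.card_fin, finrank_real_of_complex] at hcard
  have hbase : 1 + 1 / δ ≤ 2 / δ := by
    rw [← sub_nonneg]
    have : 2 / δ - (1 + 1 / δ) = (1 - δ) / δ := by field_simp; ring
    rw [this]
    exact div_nonneg (by linarith) hδ.le
  have hone : 1 ≤ 2 / δ := by
    rw [le_div_iff₀ hδ]
    linarith
  have hpow : (d : ℝ) ≤ (2 / δ) ^ (2 * finrank ℂ V) :=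
    calc
      (d : ℝ) ≤ (1 + 1 / δ) ^ (2 * finrank ℂ (LinearMap.range Φ)) := hcard
      _ ≤ (2 / δ) ^ (2 * finrank ℂ (LinearMap.range Φ)) := by gcongr
      _ ≤ _ := pow_le_pow_right₀ hone (Nat.mul_le_mul_left 2 Φ.finrank_range_le)
  calc
    Real.log d ≤ Real.log ((2 / δ) ^ (2 * finrank ℂ V)) :=
      Real.log_le_log (by exact_mod_cast hL.pos) hpow
    _ = _ := by rw [Real.log_pow]; push_cast; ring

end MyhillNerode

/-! ### Norms and measurements -/

section NormSq

variable {Q C : Type*} [Fintype Q] [Fintype C]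

theorem normSq_nonneg (v : Q → ℂ) : 0 ≤ normSq v := sq_nonneg _

theorem ofReal_normSq (v : Q → ℂ) : (normSq v : ℂ) = star v ⬝ᵥ v := by
  rw [normSq, EuclideanSpace.norm_sq_eq, dotProduct, Complex.ofReal_sum]
  refine Finset.sum_congr rfl fun i _ => ?_
  rw [Pi.star_apply, Complex.ofReal_pow, ← Complex.conj_mul']
  rfl

theorem normSq_zero : normSq (0 : Q → ℂ) = 0 := by simp [normSq]

/-- This is what makes the evolution linear: applying `M` to a vector conjugates its density matrix.
-/
theorem mul_vecMulVec_star_mul (M : Matrix Q Q ℂ) (v : Q → ℂ) :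
    M * Matrix.vecMulVec v (star v) * Mᴴ = Matrix.vecMulVec (M *ᵥ v) (star (M *ᵥ v)) := by
  rw [Matrix.mul_vecMulVec, Matrix.vecMulVec_mul, Matrix.star_mulVec]

variable [DecidableEq Q]

theorem normSq_ket (q : Q) : normSq (ket q) = 1 := by
  apply Complex.ofReal_injective
  rw [ofReal_normSq, ket]
  simp

/-- Conservation of total probability, by the completeness relation. -/
theorem sum_normSq_mulVec {M : C → Matrix Q Q ℂ} (hM : ∑ c, (M c)ᴴ * M c = 1) (v : Q → ℂ) :
    ∑ c, normSq (M c *ᵥ v) = normSq v := by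
  apply Complex.ofReal_injective
  have h : ∀ c, star (M c *ᵥ v) ⬝ᵥ (M c *ᵥ v) = star v ⬝ᵥ (((M c)ᴴ * M c) *ᵥ v) := by
    intro c
    rw [Matrix.star_mulVec, ← Matrix.mulVec_mulVec, Matrix.dotProduct_mulVec,
      Matrix.dotProduct_mulVec, Matrix.dotProduct_mulVec]
  rw [Complex.ofReal_sum]
  simp only [ofReal_normSq, h]
  rw [← dotProduct_sum, ← Matrix.sum_mulVec, hM, Matrix.one_mulVec]

theorem ProjectiveMeasurement.sum_conjTranspose_mul (μ : ProjectiveMeasurement Q C) :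
    ∑ c, (μ.proj c)ᴴ * μ.proj c = 1 := by
  rw [← μ.complete]
  refine Finset.sum_congr rfl fun c _ => ?_
  rw [← Matrix.star_eq_conjTranspose, (μ.isProj c).isSelfAdjoint.star_eq,
    (μ.isProj c).isIdempotentElem.eq]

theorem ProjectiveMeasurement.normSq_proj_mulVec_le (μ : ProjectiveMeasurement Q C) (c : C)
    (v : Q → ℂ) : normSq (μ.proj c *ᵥ v) ≤ normSq v := by
  rw [← sum_normSq_mulVec μ.sum_conjTranspose_mul v]
  exact Finset.single_le_sum (f := fun c => normSq (μ.proj c *ᵥ v))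
    (fun _ _ => normSq_nonneg _) (Finset.mem_univ c)

end NormSq

/-- A sum over the sequences labelling a nonempty word, split by the first label. -/
theorem sum_fin_length_cons {α C β : Type*} [Fintype C] [AddCommMonoid β] (a : α)
    (x : List α) (F : List (α × C) → β) :
    ∑ c : Fin (a :: x).length → C, F ((a :: x).zip (List.ofFn c)) =
      ∑ c, ∑ y : Fin x.length → C, F ((a, c) :: x.zip (List.ofFn y)) := by
  rw [← Fintype.sum_prod_type']
  refine (Fintype.sum_equiv (Fin.consEquiv fun _ : Fin (x.length + 1) => C) _ _ fun p => ?_).symm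
  simp [Fin.consEquiv, List.ofFn_succ]

/-- A quantum system controlled by a classical automaton: the classical state and the input letter
select a family of operators whose outcome drives the classical state, and each classical state
carries an operator that is applied at the end. -/
structure ControlledSystem (α Q S C : Type*) [Fintype Q] [DecidableEq Q] [Fintype C] where
  /-- The measurement operators. -/
  op : S → α → C → Matrix Q Q ℂ
  complete : ∀ s a, ∑ c, (op s a c)ᴴ * op s a c = 1
  /-- The classical transition function. -/
  step : S → α → C → S
  /-- The operators of acceptance. -/
  final : S → Matrix Q Q ℂ
  final_le : ∀ s v, normSq (final s *ᵥ v) ≤ normSq v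

/-! ### Linearization by density matrices -/

namespace ControlledSystem

variable {α Q S C : Type*} [Fintype Q] [DecidableEq Q] [Fintype C] (A : ControlledSystem α Q S C)

/-- The probability of accepting a word from the classical state `s` and the vector `v`. -/
noncomputable def prob : List α → S → (Q → ℂ) → ℝ
  | [], s, v => normSq (A.final s *ᵥ v)
  | a :: x, s, v => ∑ c, prob x (A.step s a c) (A.op s a c *ᵥ v)

theorem prob_nonneg (x : List α) (s : S) (v : Q → ℂ) : 0 ≤ A.prob x s v := by
  induction x generalizing s v with
  | nil => exact normSq_nonneg _
  | cons a x ih => exact Finset.sum_nonneg fun c _ => ih _ _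

theorem prob_le (x : List α) (s : S) (v : Q → ℂ) : A.prob x s v ≤ normSq v := by
  induction x generalizing s v with
  | nil => exact A.final_le s v
  | cons a x ih =>
    rw [← sum_normSq_mulVec (A.complete s a) v]
    exact Finset.sum_le_sum fun c _ => ih _ _

/-- The acceptance probability as a sum over the sequences of outcomes. -/
theorem prob_eq_sum (x : List α) (s : S) (v : Q → ℂ) :
    A.prob x s v = ∑ y : Fin x.length → C,
      let p := (x.zip (List.ofFn y)).foldl
        (fun p e => (A.step p.1 e.1 e.2, A.op p.1 e.1 e.2 *ᵥ p.2)) (s, v)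
      normSq (A.final p.1 *ᵥ p.2) := by
  induction x generalizing s v with
  | nil => simp [prob]
  | cons a x ih =>
    rw [prob, sum_fin_length_cons a x fun w =>
      let p := w.foldl (fun p e => (A.step p.1 e.1 e.2, A.op p.1 e.1 e.2 *ᵥ p.2)) (s, v)
      normSq (A.final p.1 *ᵥ p.2)]
    exact Finset.sum_congr rfl fun c _ => ih _ _

variable [Fintype S] [DecidableEq S]

/-- The action of a letter on families of density matrices indexed by the classical states. -/
noncomputable def evolve (a : α) : (S → Matrix Q Q ℂ) →ₗ[ℂ] (S → Matrix Q Q ℂ) :=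
  ∑ s, ∑ c, LinearMap.single ℂ (fun _ : S => Matrix Q Q ℂ) (A.step s a c) ∘ₗ
    LinearMap.mulRight ℂ (A.op s a c)ᴴ ∘ₗ LinearMap.mulLeft ℂ (A.op s a c) ∘ₗ LinearMap.proj s

/-- The action of a word on families of density matrices indexed by the classical states. -/
noncomputable def evolveWord (x : List α) : (S → Matrix Q Q ℂ) →ₗ[ℂ] (S → Matrix Q Q ℂ) :=
  x.foldl (fun T a => A.evolve a ∘ₗ T) LinearMap.id

/-- The total weight of acceptance of a family of density matrices. -/
noncomputable def weight : (S → Matrix Q Q ℂ) →ₗ[ℂ] ℂ :=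
  ∑ s, Matrix.traceLinearMap Q ℂ ℂ ∘ₗ
    LinearMap.mulRight ℂ (A.final s)ᴴ ∘ₗ LinearMap.mulLeft ℂ (A.final s) ∘ₗ LinearMap.proj s

/-- The family of density matrices of the vector `v` in the classical state `s`. -/
noncomputable def pure (s : S) (v : Q → ℂ) : S → Matrix Q Q ℂ :=
  Pi.single s (Matrix.vecMulVec v (star v))

/-- Outcomes leading to the same classical state add up their density matrices; a single vector per
classical state could not record such a mixture. -/
theorem evolve_pure (a : α) (s : S) (v : Q → ℂ) :
    A.evolve a (pure s v) = ∑ c, pure (A.step s a c) (A.op s a c *ᵥ v) := by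
  simp only [evolve, LinearMap.sum_apply, LinearMap.comp_apply, LinearMap.proj_apply,
    LinearMap.mulLeft_apply, LinearMap.mulRight_apply, LinearMap.single_apply]
  rw [Finset.sum_eq_single s]
  · refine Finset.sum_congr rfl fun c _ => ?_
    rw [pure, Pi.single_eq_same, mul_vecMulVec_star_mul, pure]
  · intro t _ ht
    simp [pure, Pi.single_eq_of_ne ht]
  · simp

theorem weight_pure (s : S) (v : Q → ℂ) :
    A.weight (pure s v) = (normSq (A.final s *ᵥ v) : ℂ) := by
  simp only [weight, LinearMap.sum_apply, LinearMap.comp_apply, LinearMap.proj_apply,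
    LinearMap.mulLeft_apply, LinearMap.mulRight_apply, Matrix.traceLinearMap_apply]
  rw [Finset.sum_eq_single s]
  · rw [pure, Pi.single_eq_same, mul_vecMulVec_star_mul, Matrix.trace_vecMulVec, ofReal_normSq,
      dotProduct_comm]
  · intro t _ ht
    simp [pure, Pi.single_eq_of_ne ht]
  · simp

theorem evolveWord_append (x y : List α) (ρ : S → Matrix Q Q ℂ) :
    A.evolveWord (x ++ y) ρ = A.evolveWord y (A.evolveWord x ρ) := by
  induction y using List.reverseRecOn with
  | nil => simp [evolveWord]
  | append_singleton y a ih =>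
    rw [← List.append_assoc]
    simp only [evolveWord, List.foldl_append, List.foldl_cons, List.foldl_nil,
      LinearMap.comp_apply] at ih ⊢
    rw [ih]

theorem weight_evolveWord_pure (x : List α) (s : S) (v : Q → ℂ) :
    A.weight (A.evolveWord x (pure s v)) = (A.prob x s v : ℂ) := by
  induction x generalizing s v with
  | nil => exact A.weight_pure s v
  | cons a x ih =>
    have h : A.evolveWord [a] (pure s v) = A.evolve a (pure s v) := rfl
    rw [← List.singleton_append, evolveWord_append, h, evolve_pure, map_sum, map_sum,
      List.singleton_append, prob, Complex.ofReal_sum]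
    exact Finset.sum_congr rfl fun c _ => ih _ _

theorem rpow_le {L : Language α} {d : ℕ} (hL : HasMinimalDFASize L d) {δ : ℝ} (s : S) (q : Q)
    (hP : RecognizesIsolated (fun x => A.prob x s (ket q)) L δ) :
    (Real.log d / (2 * Real.log (2 / δ))) ^ (4 / 9 : ℝ) ≤
      (Fintype.card Q : ℝ) * (Fintype.card S : ℝ) := by
  have hlog := hP.log_le hL
    (fun x => abs_le.2 ⟨by linarith [A.prob_nonneg x s (ket q)],
      (A.prob_le x s (ket q)).trans_eq (normSq_ket q)⟩)
    (fun x => A.evolveWord x (pure s (ket q))) (fun w => A.weight ∘ₗ A.evolveWord w)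
    (fun x w => by
      rw [LinearMap.comp_apply, ← evolveWord_append, weight_evolveWord_pure])
  obtain ⟨⟨hδ, hδ'⟩, -⟩ := hP
  have hpos : 0 < Real.log (2 / δ) := Real.log_pos (by rw [lt_div_iff₀ hδ]; linarith)
  have hdim : finrank ℂ (S → Matrix Q Q ℂ) =
      Fintype.card S * (Fintype.card Q * Fintype.card Q) := by
    simp [Module.finrank_pi_fintype, Module.finrank_matrix]
  rw [hdim] at hlog
  have hS : (1 : ℝ) ≤ Fintype.card S := by exact_mod_cast Fintype.card_pos_iff.2 ⟨s⟩
  have hQ : (1 : ℝ) ≤ Fintype.card Q := by exact_mod_cast Fintype.card_pos_iff.2 ⟨q⟩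
  push_cast at hlog
  set m : ℝ := (Fintype.card Q : ℝ)
  set k : ℝ := (Fintype.card S : ℝ)
  have hN : 1 ≤ m * k := one_le_mul_of_one_le_of_one_le hQ hS
  have hratio : Real.log d / (2 * Real.log (2 / δ)) ≤ (m * k) ^ (9 / 4 : ℝ) :=
    calc
      Real.log d / (2 * Real.log (2 / δ)) ≤ k * (m * m) := by
        rw [div_le_iff₀ (by positivity)]
        linarith
      -- Uses `1 ≤ k`. The exponent is then relaxed to `9 / 4`, the inverse of `4 / 9`, which is
      -- harmless as `1 ≤ m * k`.
      _ ≤ (m * k) ^ (2 : ℝ) := by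
        rw [Real.rpow_two]
        nlinarith [mul_nonneg (mul_nonneg (zero_le_one.trans hS) (sub_nonneg.2 hS)) (sq_nonneg m)]
      _ ≤ (m * k) ^ (9 / 4 : ℝ) := Real.rpow_le_rpow_of_exponent_le hN (by norm_num)
  calc
    _ ≤ ((m * k) ^ (9 / 4 : ℝ)) ^ (4 / 9 : ℝ) :=
      Real.rpow_le_rpow (div_nonneg (Real.log_natCast_nonneg d) (by positivity)) hratio
        (by norm_num)
    _ = m * k := by
      rw [← Real.rpow_mul (by linarith)]
      norm_num

end ControlledSystem

/-! ### The three models as controlled systems -/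

section Automata

variable {α Q S C : Type*} [Fintype Q] [DecidableEq Q] [Fintype C]

open Classical in
theorem normSq_ite_mulVec (p : Prop) (v : Q → ℂ) :
    normSq ((if p then 1 else 0 : Matrix Q Q ℂ) *ᵥ v) = if p then normSq v else 0 := by
  split_ifs <;> simp [normSq_zero]

open Classical in
theorem normSq_ite_mulVec_le (p : Prop) (v : Q → ℂ) :
    normSq ((if p then 1 else 0 : Matrix Q Q ℂ) *ᵥ v) ≤ normSq v := by
  rw [normSq_ite_mulVec]
  split_ifs
  · exact le_rfl
  · exact normSq_nonneg v

open Classical in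
/-- The controlled system of a 1QCFA. -/
noncomputable def QCFA.toControlledSystem (A : QCFA α Q S C) : ControlledSystem α Q S C where
  op s a := (A.meas s a).op
  complete s a := (A.meas s a).complete
  step := A.step
  -- Acceptance by classical state: the identity keeps the whole weight, zero discards it.
  final s := if s ∈ A.accept then 1 else 0
  final_le _ v := normSq_ite_mulVec_le _ v

theorem QCFA.prob_toControlledSystem [Fintype S] [DecidableEq S] (A : QCFA α Q S C) (x : List α) :
    A.toControlledSystem.prob x A.cstart (ket A.start) = A.acceptProb x := by
  rw [ControlledSystem.prob_eq_sum, QCFA.acceptProb]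
  exact Finset.sum_congr rfl fun c _ => normSq_ite_mulVec _ _

/-- The controlled system of a 1QFAC. -/
noncomputable def QFAC.toControlledSystem (A : QFAC α Q S) : ControlledSystem α Q S Unit where
  -- With a single outcome, completeness is unitarity.
  op s a _ := A.U s a
  complete s a := by
    simpa [Matrix.star_eq_conjTranspose] using Unitary.coe_star_mul_self (A.U s a)
  step s a _ := A.step s a
  final s := (A.meas s).proj true
  final_le s v := (A.meas s).normSq_proj_mulVec_le true v

theorem QFAC.prob_toControlledSystem (A : QFAC α Q S) (x : List α) :
    A.toControlledSystem.prob x A.cstart (ket A.start) = A.acceptProb x := by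
  suffices h : ∀ s v, A.toControlledSystem.prob x s v =
      let p := x.foldl (fun p a => (A.step p.1 a, (A.U p.1 a : Matrix Q Q ℂ) *ᵥ p.2)) (s, v)
      normSq ((A.meas p.1).proj true *ᵥ p.2) from h _ _
  induction x with
  | nil => intro s v; rfl
  | cons a x ih =>
    intro s v
    rw [ControlledSystem.prob, Fintype.sum_unique, ih]
    rfl

open Classical in
/-- The controlled system of a CL-1QFA and a deterministic automaton for its control language. -/
noncomputable def CL1QFA.toControlledSystem (A : CL1QFA α Q C) (M : DFA C S) :
    ControlledSystem α Q S C where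
  op _ a c := A.meas.proj c * (A.U a : Matrix Q Q ℂ)
  complete _ a := by
    simp only [Matrix.conjTranspose_mul]
    have h : ∀ c, (A.U a : Matrix Q Q ℂ)ᴴ * (A.meas.proj c)ᴴ *
        (A.meas.proj c * (A.U a : Matrix Q Q ℂ)) =
        (A.U a : Matrix Q Q ℂ)ᴴ * ((A.meas.proj c)ᴴ * A.meas.proj c) * (A.U a : Matrix Q Q ℂ) :=
      fun c => by simp only [Matrix.mul_assoc]
    simp only [h]
    rw [← Finset.sum_mul, ← Finset.mul_sum, A.meas.sum_conjTranspose_mul, mul_one]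
    exact Unitary.coe_star_mul_self (A.U a)
  step s _ c := M.step s c
  final s := if s ∈ M.accept then 1 else 0
  final_le _ v := normSq_ite_mulVec_le _ v

/-- The control automaton reads the outcomes without influencing the quantum part, so the run splits
into two independent folds. Equal lengths ensure that `zip` drops no outcome. -/
theorem CL1QFA.foldl_zip (A : CL1QFA α Q C) (M : DFA C S) (x : List α) (y : List C)
    (hxy : x.length = y.length) (s : S) (v : Q → ℂ) :
    (x.zip y).foldl (fun p e => ((A.toControlledSystem M).step p.1 e.1 e.2,
        (A.toControlledSystem M).op p.1 e.1 e.2 *ᵥ p.2)) (s, v) =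
      (M.evalFrom s y, (x.zip y).foldl
        (fun v p => A.meas.proj p.2 *ᵥ ((A.U p.1 : Matrix Q Q ℂ) *ᵥ v)) v) := by
  induction x generalizing y s v with
  | nil =>
    obtain rfl : y = [] := List.length_eq_zero_iff.1 hxy.symm
    rfl
  | cons a x ih =>
    cases y with
    | nil => simp at hxy
    | cons c y =>
      rw [List.zip_cons_cons, List.foldl_cons, List.foldl_cons, DFA.evalFrom_cons,
        ← ih y (by simpa using hxy), Matrix.mulVec_mulVec]
      rfl

theorem CL1QFA.prob_toControlledSystem [Fintype S] [DecidableEq S] (A : CL1QFA α Q C)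
    (M : DFA C S) (hM : M.accepts = A.control) (x : List α) :
    (A.toControlledSystem M).prob x M.start (ket A.start) = A.acceptProb x := by
  rw [ControlledSystem.prob_eq_sum, CL1QFA.acceptProb]
  refine Finset.sum_congr rfl fun y _ => ?_
  rw [A.foldl_zip M x (List.ofFn y) (by simp), ← hM]
  exact normSq_ite_mulVec _ _

end Automata

end SemiQuantum

theorem theorem4 {α : Type*} [Finite α] (L : Language α) (d : ℕ)
    (hL : SemiQuantum.HasMinimalDFASize L d) (δ : ℝ) :
    -- CL-1QFA; the classical states are those of the minimal DFA of the control language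
    (∀ (Q C : Type*) [Fintype Q] [DecidableEq Q] [Fintype C]
        (A : SemiQuantum.CL1QFA α Q C) (k : ℕ),
      SemiQuantum.HasMinimalDFASize A.control k →
      SemiQuantum.RecognizesIsolated A.acceptProb L δ →
      (Real.log d / (2 * Real.log (2 / δ))) ^ (4 / 9 : ℝ) ≤ (Fintype.card Q : ℝ) * (k : ℝ)) ∧
    -- 1QFAC
    (∀ (Q S : Type*) [Fintype Q] [DecidableEq Q] [Fintype S]
        (A : SemiQuantum.QFAC α Q S),
      SemiQuantum.RecognizesIsolated A.acceptProb L δ →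
      (Real.log d / (2 * Real.log (2 / δ))) ^ (4 / 9 : ℝ) ≤
        (Fintype.card Q : ℝ) * (Fintype.card S : ℝ)) ∧
    -- 1QCFA
    (∀ (Q S C : Type*) [Fintype Q] [DecidableEq Q] [Fintype S] [Fintype C]
        (A : SemiQuantum.QCFA α Q S C),
      SemiQuantum.RecognizesIsolated A.acceptProb L δ →
      (Real.log d / (2 * Real.log (2 / δ))) ^ (4 / 9 : ℝ) ≤
        (Fintype.card Q : ℝ) * (Fintype.card S : ℝ)) := by
  refine ⟨?_, ?_, ?_⟩
  · intro Q C _ _ _ A k hk hP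
    obtain ⟨M, hM⟩ := hk.1
    rw [← funext (A.prob_toControlledSystem M hM)] at hP
    simpa using (A.toControlledSystem M).rpow_le hL M.start A.start hP
  · intro Q S _ _ _ A hP
    classical
    rw [← funext A.prob_toControlledSystem] at hP
    exact A.toControlledSystem.rpow_le hL A.cstart A.start hP
  · intro Q S C _ _ _ _ A hP
    classical
    rw [← funext A.prob_toControlledSystem] at hP
    exact A.toControlledSystem.rpow_le hL A.cstart A.start hP
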